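/- For $\bar\gamma>0$, $\kappa\ge 0$, $\mu>0$, $m>0$, the $\kappa$-$\mu$ shadowed distribution $\mathcal S_{\kappa\mu}(\bar\gamma;\kappa,\mu,m)$ with mean $\bar\gamma$ is the law on $(0,\infty)$ with density $f(x)=\int_0^\infty f(x\mid\xi)\,f_\xi(\xi)\,d\xi$, where $f_\xi(\xi)=\frac{2m^m}{\Gamma(m)}\xi^{2m-1}e^{-m\xi^2}$ is the Nakagami-$m$ density with $\mathbb E[\xi^2]=1$ and $$f(x\mid\xi)=\frac{\mu(1+\kappa)^{\frac{\mu+1}{2}}}{\bar\gamma\,\kappa^{\frac{\mu-1}{2}}e^{\xi^2\mu\kappa}}\Big(\frac{x}{\xi^2\bar\gamma}\Big)^{\frac{\mu-1}{2}}e^{-\frac{\mu(1+\kappa)x}{\bar\gamma}}\,I_{\mu-1}\Big(2\mu\xi\sqrt{\tfrac{\kappa(1+\kappa)x}{\bar\gamma}}\Big)$$ is the conditional $\kappa$-$\mu$ density ($I_\nu$ is the modified Bessel function of the first kind; for $\kappa=0$ the expression is read as its limit as $\kappa\to0$, the gamma density of shape $\mu$ and rate $\mu/\bar\gamma$). Let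 $M\ge 1$, fix $\kappa_k\ge 0$, $\mu_k>0$, $m_k>0$ for $k=1,\dots,M$, and for $\bar\gamma_1,\dots,\bar\gamma_M>0$ let $\gamma_k\sim\mathcal S_{\kappa\mu}(\bar\gamma_k;\kappa_k,\mu_k,m_k)$ be mutually independent, not necessarily identically distributed. Then the sum $\gamma=\sum_{k=1}^M\gamma_k$ has a PDF $f_\gamma$ that is continuous on $(0,\infty)$, and for every fixed $x>0$, as $\bar\gamma_k\to\infty$ for all $k$ (jointly, at arbitrary relative rates), $$f_\gamma(x)\sim\left(\frac{1}{\Gamma\left(\sum_{k=1}^M\mu_k\right)}\prod_{k=1}^M\frac{\mu_k^{\mu_k}m_k^{m_k}(1+\kappa_k)^{\mu_k}}{(\mu_k\kappa_k+m_k)^{m_k}}\Big(\frac{1}{\bar\gamma_k}\Big)^{\mu_k}\right)x^{\sum_{k=1}^M\mu_k-1},$$ and the CDF $F_\gamma$ satisfies $$F_\gamma(x)\sim\left(\frac{1}{\Gamma\left(1+\sum_{k=1}^M\mu_k\right)}\prod_{k=1}^M\frac{\mu_k^{\mu_k}m_k^{m_k}(1+\kappa_k)^{\mu_k}}{(\mu_k\kappa_k+m_k)^{m_k}}\Big(\frac{1}{\bar\gamma_k}\Big)^{\mu_k}\right)x^{\sum_{k=1}^M\mu_k}.$$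 Here $a\sim b$ means that $a/b\to1$. -/

import Mathlib

open MeasureTheory ProbabilityTheory Filter Asymptotics

noncomputable section

/-- The modified Bessel function of the first kind `I_ν(z)`, through its power series
(used for real order `ν > -1` and `z > 0`). -/
def besselI (ν z : ℝ) : ℝ :=
  ∑' j : ℕ, (z / 2) ^ (2 * (j : ℝ) + ν) / (Nat.factorial j * Real.Gamma (j + ν + 1))

/-- The density on `(0, ∞)` of a Nakagami-`m` random variable `ξ` with `E[ξ²] = 1`. -/
def nakagamiPDF (m ξ : ℝ) : ℝ :=
  2 * m ^ m / Real.Gamma m * ξ ^ (2 * m - 1) * Real.exp (-(m * ξ ^ 2))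

/-- The density on `(0, ∞)` of the `κ-μ` SNR `γ`, conditional on the shadowing amplitude `ξ > 0`.
For `κ = 0` the Bessel expression is `0 / 0`; its limit as `κ → 0`, which does not depend on `ξ`,
is the density of the gamma distribution of shape `μ` and rate `μ / γbar`. -/
def kappaMuCondPDF (γbar κ μ ξ γ : ℝ) : ℝ :=
  if κ = 0 then gammaPDFReal μ (μ / γbar) γ
  else
    μ * (1 + κ) ^ ((μ + 1) / 2) / (γbar * κ ^ ((μ - 1) / 2) * Real.exp (ξ ^ 2 * μ * κ))
      * (γ / (ξ ^ 2 * γbar)) ^ ((μ - 1) / 2)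
      * Real.exp (-(μ * (1 + κ) * γ / γbar))
      * besselI (μ - 1) (2 * μ * ξ * Real.sqrt (κ * (1 + κ) * γ / γbar))

/-- The `κ-μ` shadowed distribution with mean `γbar` and shape parameters `κ, μ, m`: the law on
`(0, ∞)` whose density is the conditional `κ-μ` density, averaged over the Nakagami-`m` distributed
shadowing amplitude `ξ`. -/
def kappaMuShadowed (γbar κ μ m : ℝ) : Measure ℝ :=
  (volume.restrict (Set.Ioi 0)).withDensity fun γ =>
    ∫⁻ ξ in Set.Ioi (0 : ℝ), ENNReal.ofReal (kappaMuCondPDF γbar κ μ ξ γ * nakagamiPDF m ξ)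

/-- `f` is the probability density function of the law `ν` of a positive random variable, in its
version that is continuous on `(0, ∞)` and zero on `(-∞, 0]` (there is at most one such `f`). -/
structure IsContinuousPDF (f : ℝ → ℝ) (ν : Measure ℝ) : Prop where
  nonneg : ∀ x, 0 ≤ f x
  eq_zero : ∀ x ≤ 0, f x = 0
  continuousOn : ContinuousOn f (Set.Ioi 0)
  law_eq : ν = volume.withDensity fun x => ENNReal.ofReal (f x)

end

/-! Every law involved has density `x ^ (a - 1) / Γ(a) * h x` with `h` continuous on the whole line;
the possible singularity at 0 sits in the power. Under convolution the substitution `y = x s` and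
the Beta integral add the exponents and replace the two factors by `betaMean`, their average over a
beta law (`lconvolution_powerDensity`). Averaging preserves relative closeness to constants on `[0,
X]`, and the constants multiply (`LocallyUniformlyAsymptotic.betaMean`). Only relative errors occur,
so the rates at which the means diverge need not be compared.

For one summand, expanding the Bessel function and integrating out the shadowing termwise gives a
constant times `exp (-t) * ₁F₁(m; μ; c t)` with `t = μ (1 + κ) x / γbar`. As `γbar → ∞`, `t → 0` and
this product tends to 1, leaving the stated constant. Induction on the summands gives the density;
one more convolution, with the indicator of `(0, ∞)`, gives the distribution function. -/

/-! ### Power densities and their convolution -/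

/-- The density `x ^ (a - 1) / Γ(a) * h x` on `(0, ∞)`, extended by zero. -/
noncomputable def powerDensity (a : ℝ) (h : ℝ → ℝ) (x : ℝ) : ℝ :=
  if 0 < x then x ^ (a - 1) / Real.Gamma a * h x else 0

/-- The average of `h (x s) k (x (1 - s))` over a beta distributed `s`. -/
noncomputable def betaMean (a b : ℝ) (h k : ℝ → ℝ) (x : ℝ) : ℝ :=
  ∫ s, h (x * s) * k (x * (1 - s)) ∂(betaMeasure a b)

theorem powerDensity_of_pos (a : ℝ) (h : ℝ → ℝ) {x : ℝ} (hx : 0 < x) :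
    powerDensity a h x = x ^ (a - 1) / Real.Gamma a * h x := if_pos hx

theorem powerDensity_of_nonpos (a : ℝ) (h : ℝ → ℝ) {x : ℝ} (hx : x ≤ 0) :
    powerDensity a h x = 0 := if_neg hx.not_gt

theorem powerDensity_nonneg {a : ℝ} (ha : 0 < a) {h : ℝ → ℝ} (h0 : ∀ x, 0 ≤ x → 0 ≤ h x) (x : ℝ) :
    0 ≤ powerDensity a h x := by
  unfold powerDensity
  split_ifs with hx
  · have := h0 x hx.le
    have := Real.Gamma_pos_of_pos ha
    positivity
  · rfl

theorem measurable_powerDensity (a : ℝ) {h : ℝ → ℝ} (hh : Continuous h) :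
    Measurable (powerDensity a h) :=
  Measurable.ite measurableSet_Ioi
    (((measurable_id.pow_const _).div_const _).mul hh.measurable) measurable_const

theorem continuousOn_powerDensity (a : ℝ) {h : ℝ → ℝ} (hh : Continuous h) :
    ContinuousOn (powerDensity a h) (Set.Ioi 0) := by
  have : ContinuousOn (fun x : ℝ => x ^ (a - 1) / Real.Gamma a * h x) (Set.Ioi 0) := by
    refine ContinuousOn.mul (ContinuousOn.div_const ?_ _) hh.continuousOn
    exact continuousOn_id.rpow_const fun x hx => Or.inl (ne_of_gt hx)
  exact this.congr fun x hx => powerDensity_of_pos a h hx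

theorem measurable_betaPDF (a b : ℝ) : Measurable (betaPDF a b) :=
  (measurable_betaPDFReal a b).ennreal_ofReal

theorem ae_betaMeasure_mem_Ioo (a b : ℝ) : ∀ᵐ s ∂(betaMeasure a b), s ∈ Set.Ioo (0 : ℝ) 1 := by
  rw [betaMeasure, ae_withDensity_iff (measurable_betaPDF a b)]
  refine ae_of_all _ fun s hs => ?_
  by_contra hn
  refine hs ?_
  rw [betaPDF_eq, if_neg (show ¬(0 < s ∧ s < 1) from hn), ENNReal.ofReal_zero]

theorem exists_abs_le_of_continuous {h : ℝ → ℝ} (hh : Continuous h) (R : ℝ) :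
    ∃ C, 0 ≤ C ∧ ∀ y, |y| ≤ R → |h y| ≤ C := by
  obtain ⟨C, hC⟩ := (isCompact_Icc (a := -R) (b := R)).exists_bound_of_continuousOn hh.continuousOn
  refine ⟨max C 0, le_max_right _ _, fun y hy => ?_⟩
  exact (hC y (abs_le.1 hy)).trans (le_max_left _ _)

theorem abs_mul_le_of_mem_Ioo {x s R : ℝ} (hx : |x| ≤ R) (hs : s ∈ Set.Ioo (0 : ℝ) 1) :
    |x * s| ≤ R ∧ |x * (1 - s)| ≤ R := by
  have h0 := abs_nonneg x
  rw [abs_mul, abs_mul, abs_of_pos hs.1, abs_of_pos (sub_pos.2 hs.2)]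
  exact ⟨by nlinarith [hs.1, hs.2], by nlinarith [hs.1, hs.2]⟩

/-- Dominated convergence: for `s` in `(0, 1)` both arguments are at most `|x|` in absolute value,
so bounds of `h` and `k` on one compact interval serve for all `x` near `x₀`. -/
theorem continuous_betaMean {a b : ℝ} (ha : 0 < a) (hb : 0 < b) {h k : ℝ → ℝ}
    (hh : Continuous h) (hk : Continuous k) : Continuous (betaMean a b h k) := by
  have := isProbabilityMeasureBeta ha hb
  refine continuous_iff_continuousAt.2 fun x₀ => ?_
  obtain ⟨C, hC0, hC⟩ := exists_abs_le_of_continuous hh (|x₀| + 1)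
  obtain ⟨D, hD0, hD⟩ := exists_abs_le_of_continuous hk (|x₀| + 1)
  refine continuousAt_of_dominated (bound := fun _ => C * D) ?_ ?_ (integrable_const _) ?_
  · exact Eventually.of_forall fun x => (by fun_prop : Continuous _).aestronglyMeasurable
  · have : ∀ᶠ x in nhds x₀, |x| < |x₀| + 1 :=
      continuous_abs.continuousAt.eventually_lt_const (lt_add_one _)
    filter_upwards [this] with x hx
    filter_upwards [ae_betaMeasure_mem_Ioo a b] with s hs
    obtain ⟨h1, h2⟩ := abs_mul_le_of_mem_Ioo hx.le hs
    rw [Real.norm_eq_abs, abs_mul]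
    exact mul_le_mul (hC _ h1) (hD _ h2) (abs_nonneg _) hC0
  · exact ae_of_all _ fun s => (by fun_prop : Continuous _).continuousAt

theorem integrable_mul_betaMeasure {a b : ℝ} (ha : 0 < a) (hb : 0 < b) {h k : ℝ → ℝ}
    (hh : Continuous h) (hk : Continuous k) (x : ℝ) :
    Integrable (fun s => h (x * s) * k (x * (1 - s))) (betaMeasure a b) := by
  have := isProbabilityMeasureBeta ha hb
  obtain ⟨C, hC0, hC⟩ := exists_abs_le_of_continuous hh |x|
  obtain ⟨D, hD0, hD⟩ := exists_abs_le_of_continuous hk |x|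
  refine Integrable.of_bound (by fun_prop : Continuous _).aestronglyMeasurable (C * D) ?_
  filter_upwards [ae_betaMeasure_mem_Ioo a b] with s hs
  obtain ⟨h1, h2⟩ := abs_mul_le_of_mem_Ioo le_rfl hs
  rw [Real.norm_eq_abs, abs_mul]
  exact mul_le_mul (hC _ h1) (hD _ h2) (abs_nonneg _) hC0

theorem ae_betaMeasure_mul_nonneg (a b : ℝ) {h k : ℝ → ℝ}
    (h0 : ∀ x, 0 ≤ x → 0 ≤ h x) (k0 : ∀ x, 0 ≤ x → 0 ≤ k x) {x : ℝ} (hx : 0 ≤ x) :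
    ∀ᵐ s ∂(betaMeasure a b), 0 ≤ h (x * s) * k (x * (1 - s)) := by
  filter_upwards [ae_betaMeasure_mem_Ioo a b] with s hs
  exact mul_nonneg (h0 _ (mul_nonneg hx hs.1.le)) (k0 _ (mul_nonneg hx (sub_nonneg.2 hs.2.le)))

theorem betaMean_nonneg (a b : ℝ) {h k : ℝ → ℝ}
    (h0 : ∀ x, 0 ≤ x → 0 ≤ h x) (k0 : ∀ x, 0 ≤ x → 0 ≤ k x) (x : ℝ) (hx : 0 ≤ x) :
    0 ≤ betaMean a b h k x :=
  integral_nonneg_of_ae (ae_betaMeasure_mul_nonneg a b h0 k0 hx)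

/-- The integrand of the convolution after `y = x s`, with Jacobian `x`. The powers of `s` and `1 -
s` form the beta density, and `B(a, b) = Γ(a) Γ(b) / Γ(a + b)` turns the two normalizations into
one. For `s` outside `(0, 1)` one argument is nonpositive and both sides vanish. -/
theorem powerDensity_mul_rescaled {a b : ℝ} (ha : 0 < a) (hb : 0 < b) (h k : ℝ → ℝ) {x : ℝ}
    (hx : 0 < x) (s : ℝ) :
    x * (powerDensity a h (x * s) * powerDensity b k (-(x * s) + x)) =
      x ^ (a + b - 1) / Real.Gamma (a + b) *
        (betaPDFReal a b s * (h (x * s) * k (x * (1 - s)))) := by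
  have e : -(x * s) + x = x * (1 - s) := by ring
  rw [e, betaPDFReal]
  by_cases hs : 0 < s ∧ s < 1
  · have h1 : 0 < 1 - s := sub_pos.2 hs.2
    rw [if_pos hs, powerDensity_of_pos _ _ (mul_pos hx hs.1), powerDensity_of_pos _ _ (mul_pos hx h1),
      Real.mul_rpow hx.le hs.1.le, Real.mul_rpow hx.le h1.le, beta,
      show a + b - 1 = 1 + (a - 1) + (b - 1) by ring, Real.rpow_add hx, Real.rpow_add hx,
      Real.rpow_one]
    have := Real.Gamma_pos_of_pos ha
    have := Real.Gamma_pos_of_pos hb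
    have := Real.Gamma_pos_of_pos (add_pos ha hb)
    field_simp
  · rw [if_neg hs]
    by_cases h0 : 0 < s
    · rw [powerDensity_of_nonpos b k]
      · simp
      · have : 1 ≤ s := by by_contra hc; exact hs ⟨h0, lt_of_not_ge hc⟩
        nlinarith
    · rw [powerDensity_of_nonpos a h]
      · simp
      · nlinarith

/-- Densities of the form `powerDensity` are stable under convolution. -/
theorem lconvolution_powerDensity {a b : ℝ} (ha : 0 < a) (hb : 0 < b) {h k : ℝ → ℝ}
    (hh : Continuous h) (hk : Continuous k)
    (h0 : ∀ x, 0 ≤ x → 0 ≤ h x) (k0 : ∀ x, 0 ≤ x → 0 ≤ k x) (x : ℝ) :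
    lconvolution (fun y => ENNReal.ofReal (powerDensity a h y))
      (fun y => ENNReal.ofReal (powerDensity b k y)) volume x =
      ENNReal.ofReal (powerDensity (a + b) (betaMean a b h k) x) := by
  rw [lconvolution_def]
  rcases le_or_gt x 0 with hx | hx
  · rw [powerDensity_of_nonpos _ _ hx, ENNReal.ofReal_zero]
    refine lintegral_eq_zero_of_ae_eq_zero (ae_of_all _ fun y => ?_)
    rcases le_or_gt y 0 with hy | hy
    · simp [powerDensity_of_nonpos a h hy]
    · simp [powerDensity_of_nonpos b k (by linarith : -y + x ≤ 0)]
  have hma := measurable_powerDensity a hh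
  have hmb := measurable_powerDensity b hk
  have hG : 0 ≤ x ^ (a + b - 1) / Real.Gamma (a + b) := by
    have := Real.Gamma_pos_of_pos (add_pos ha hb)
    positivity
  -- Substitution `y = x s`, by writing Lebesgue measure as `|x|` times its image under
  -- multiplication by `x`.
  conv_lhs => rw [← Real.smul_map_volume_mul_left hx.ne']
  rw [lintegral_smul_measure, lintegral_map (by fun_prop) (by fun_prop), abs_of_pos hx, smul_eq_mul,
    ← lintegral_const_mul _ (by fun_prop), powerDensity_of_pos _ _ hx, ENNReal.ofReal_mul hG,
    betaMean, ofReal_integral_eq_lintegral_ofReal (integrable_mul_betaMeasure ha hb hh hk x)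
      (ae_betaMeasure_mul_nonneg a b h0 k0 hx.le), betaMeasure,
    lintegral_withDensity_eq_lintegral_mul _ (measurable_betaPDF a b) (by fun_prop),
    ← lintegral_const_mul _ ((measurable_betaPDF a b).mul (by fun_prop))]
  refine lintegral_congr fun s => ?_
  have hb0 : 0 ≤ betaPDFReal a b s := by
    by_cases hs : 0 < s ∧ s < 1
    · exact (betaPDFReal_pos hs.1 hs.2 ha hb).le
    · rw [betaPDFReal, if_neg hs]
  rw [← ENNReal.ofReal_mul (powerDensity_nonneg ha h0 _), ← ENNReal.ofReal_mul hx.le,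
    powerDensity_mul_rescaled ha hb h k hx s, ENNReal.ofReal_mul hG, ENNReal.ofReal_mul hb0]
  rfl

theorem conv_withDensity_powerDensity {a b : ℝ} (ha : 0 < a) (hb : 0 < b) {h k : ℝ → ℝ}
    (hh : Continuous h) (hk : Continuous k)
    (h0 : ∀ x, 0 ≤ x → 0 ≤ h x) (k0 : ∀ x, 0 ≤ x → 0 ≤ k x) :
    Measure.conv (volume.withDensity fun x => ENNReal.ofReal (powerDensity a h x))
      (volume.withDensity fun x => ENNReal.ofReal (powerDensity b k x)) =
      volume.withDensity fun x => ENNReal.ofReal (powerDensity (a + b) (betaMean a b h k) x) := by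
  rw [conv_withDensity_eq_lconvolution (measurable_powerDensity a hh).ennreal_ofReal
    (measurable_powerDensity b hk).ennreal_ofReal]
  congr 1
  ext x
  exact lconvolution_powerDensity ha hb hh hk h0 k0 x

/-- The distribution function of a law with a `powerDensity`. -/
theorem cdf_withDensity_powerDensity {a : ℝ} (ha : 0 < a) {h : ℝ → ℝ}
    (hh : Continuous h) (h0 : ∀ x, 0 ≤ x → 0 ≤ h x) (ν : Measure ℝ) [IsProbabilityMeasure ν]
    (hν : ν = volume.withDensity fun x => ENNReal.ofReal (powerDensity a h x)) (x : ℝ) :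
    cdf ν x = powerDensity (a + 1) (betaMean a 1 h fun _ => 1) x := by
  have k0 : ∀ x : ℝ, 0 ≤ x → 0 ≤ (fun _ : ℝ => (1 : ℝ)) x := fun _ _ => zero_le_one
  -- With exponent 1 and factor 1 the power density is the indicator of `(0, ∞)`, so convolving with
  -- it integrates over `y < x`. The endpoint is dropped because that indicator vanishes at 0.
  rw [cdf_eq_real, measureReal_def, ← ENNReal.toReal_ofReal
    (powerDensity_nonneg (by linarith : 0 < a + 1) (betaMean_nonneg a 1 h0 k0) x),
    ← lconvolution_powerDensity ha one_pos hh continuous_const h0 k0, hν,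
    withDensity_apply _ measurableSet_Iic, ← setLIntegral_congr (Iio_ae_eq_Iic (a := x)),
    ← lintegral_indicator measurableSet_Iio, lconvolution_def]
  congr 1
  refine lintegral_congr fun y => ?_
  by_cases hy : y < x
  · rw [Set.indicator_of_mem (Set.mem_Iio.2 hy), powerDensity_of_pos 1 _ (by linarith : 0 < -y + x)]
    simp
  · rw [Set.indicator_of_notMem (by simpa using hy),
      powerDensity_of_nonpos 1 _ (by linarith : -y + x ≤ 0)]
    simp

/-! ### Locally uniform relative asymptotics -/

/-- The functions `h i` are asymptotic to the constants `A i`, uniformly on compact subsets of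
`[0, ∞)`. -/
def LocallyUniformlyAsymptotic {ι : Type*} (l : Filter ι) (h : ι → ℝ → ℝ) (A : ι → ℝ) : Prop :=
  ∀ X : ℝ, 0 < X → ∀ ε : ℝ, 0 < ε → ∀ᶠ i in l, ∀ y ∈ Set.Icc 0 X, |h i y - A i| ≤ ε * A i

theorem abs_mul_sub_mul_le {u v A B δ : ℝ} (hA : 0 < A) (hB : 0 < B) (hδ1 : δ ≤ 1)
    (hu : |u - A| ≤ δ * A) (hv : |v - B| ≤ δ * B) : |u * v - A * B| ≤ 3 * δ * (A * B) := by
  have hδ : 0 ≤ δ := by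
    by_contra hc
    nlinarith [abs_nonneg (u - A)]
  have e : u * v - A * B = (u - A) * (v - B) + (u - A) * B + A * (v - B) := by ring
  rw [e]
  have h1 : |(u - A) * (v - B)| ≤ δ * A * (δ * B) := by
    rw [abs_mul]
    exact mul_le_mul hu hv (abs_nonneg _) (by positivity)
  have h2 : |(u - A) * B| ≤ δ * A * B := by
    rw [abs_mul, abs_of_pos hB]
    exact mul_le_mul_of_nonneg_right hu hB.le
  have h3 : |A * (v - B)| ≤ A * (δ * B) := by
    rw [abs_mul, abs_of_pos hA]
    exact mul_le_mul_of_nonneg_left hv hA.le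
  have h4 : δ * A * (δ * B) ≤ δ * (A * B) := by
    have : 0 ≤ δ * (A * B) := by positivity
    nlinarith
  have := abs_add_three ((u - A) * (v - B)) ((u - A) * B) (A * (v - B))
  linarith

/-- For `y` in `[0, X]` the points `y s` and `y (1 - s)` stay in `[0, X]`, so the integrand is
uniformly close to `A i * B i`, and averaging over a probability measure keeps the bound. -/
theorem LocallyUniformlyAsymptotic.betaMean {ι : Type*} {l : Filter ι} {h k : ι → ℝ → ℝ}
    {A B : ι → ℝ} (hhA : LocallyUniformlyAsymptotic l h A) (hkB : LocallyUniformlyAsymptotic l k B)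
    (hA : ∀ i, 0 < A i) (hB : ∀ i, 0 < B i)
    (hh : ∀ i, Continuous (h i)) (hk : ∀ i, Continuous (k i))
    {a b : ℝ} (ha : 0 < a) (hb : 0 < b) :
    LocallyUniformlyAsymptotic l (fun i => betaMean a b (h i) (k i)) (fun i => A i * B i) := by
  intro X hX ε hε
  -- Relative errors `δ ≤ 1` in two factors give at most `2 δ + δ ^ 2 ≤ 3 δ` in the product.
  have hδ : 0 < min 1 (ε / 3) := by positivity
  filter_upwards [hhA X hX _ hδ, hkB X hX _ hδ] with i h1 h2 y hy
  have := isProbabilityMeasureBeta ha hb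
  have e : _root_.betaMean a b (h i) (k i) y - A i * B i =
      ∫ s, (h i (y * s) * k i (y * (1 - s)) - A i * B i) ∂(betaMeasure a b) := by
    rw [integral_sub (integrable_mul_betaMeasure ha hb (hh i) (hk i) y) (integrable_const _)]
    simp [_root_.betaMean]
  rw [e]
  suffices H : ∀ᵐ s ∂(betaMeasure a b),
      ‖h i (y * s) * k i (y * (1 - s)) - A i * B i‖ ≤ ε * (A i * B i) by
    simpa using norm_integral_le_of_norm_le_const H
  filter_upwards [ae_betaMeasure_mem_Ioo a b] with s hs
  have m1 : y * s ∈ Set.Icc 0 X :=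
    ⟨mul_nonneg hy.1 hs.1.le, by nlinarith [hy.1, hy.2, hs.1, hs.2]⟩
  have m2 : y * (1 - s) ∈ Set.Icc 0 X :=
    ⟨mul_nonneg hy.1 (sub_nonneg.2 hs.2.le), by nlinarith [hy.1, hy.2, hs.1, hs.2]⟩
  refine (abs_mul_sub_mul_le (hA i) (hB i) (min_le_left _ _) (h1 _ m1) (h2 _ m2)).trans ?_
  have : 3 * min 1 (ε / 3) ≤ ε := by linarith [min_le_right 1 (ε / 3)]
  exact mul_le_mul_of_nonneg_right this (mul_pos (hA i) (hB i)).le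

theorem LocallyUniformlyAsymptotic.const {ι : Type*} (l : Filter ι) :
    LocallyUniformlyAsymptotic l (fun _ _ => (1 : ℝ)) (fun _ => 1) := by
  intro X _ ε hε
  exact Eventually.of_forall fun i y _ => by simpa using hε.le

theorem LocallyUniformlyAsymptotic.powerDensity {ι : Type*} {l : Filter ι} {h : ι → ℝ → ℝ}
    {A : ι → ℝ} (hhA : LocallyUniformlyAsymptotic l h A) (hA : ∀ i, 0 < A i) (a : ℝ)
    {x : ℝ} (hx : 0 < x) :
    (fun i => powerDensity a (h i) x) ~[l] fun i => 1 / Real.Gamma a * A i * x ^ (a - 1) := by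
  have key : (fun i => h i x) ~[l] A := by
    refine IsLittleO.isEquivalent (isLittleO_iff.2 fun ε hε => ?_)
    filter_upwards [hhA x hx ε hε] with i hi
    simpa [abs_of_pos (hA i)] using hi x ⟨hx.le, le_rfl⟩
  have e1 : (fun i => _root_.powerDensity a (h i) x) =
      (fun _ => x ^ (a - 1) / Real.Gamma a) * fun i => h i x := by
    funext i
    exact powerDensity_of_pos a (h i) hx
  have e2 : (fun i => 1 / Real.Gamma a * A i * x ^ (a - 1)) =
      (fun _ => x ^ (a - 1) / Real.Gamma a) * A := by
    funext i
    simp only [Pi.mul_apply]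
    ring
  rw [e1, e2]
  exact IsEquivalent.refl.mul key

/-! ### Kummer and Bessel series -/

/-- The ratio bound gives `d j ≤ d 0 * C ^ j`, so the exponential series at `C * |z|` dominates. -/
theorem summable_mul_pow_div_factorial {d : ℕ → ℝ} (hd : ∀ j, 0 ≤ d j) {C : ℝ} (hC : 0 ≤ C)
    (h : ∀ j, d (j + 1) ≤ C * d j) (z : ℝ) :
    Summable fun j : ℕ => d j * z ^ j / (j.factorial : ℝ) := by
  have hb : ∀ j, d j ≤ d 0 * C ^ j := by
    intro j
    induction j with
    | zero => simp
    | succ j ih =>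
      calc d (j + 1) ≤ C * d j := h j
        _ ≤ C * (d 0 * C ^ j) := mul_le_mul_of_nonneg_left ih hC
        _ = d 0 * C ^ (j + 1) := by ring
  refine Summable.of_norm_bounded ((Real.summable_pow_div_factorial (C * |z|)).mul_left (d 0)) ?_
  intro j
  rw [Real.norm_eq_abs, abs_div, abs_mul, abs_pow, abs_of_nonneg (hd j), Nat.abs_cast, mul_pow,
    mul_div_assoc, ← mul_div_assoc (d 0)]
  rw [← mul_div_assoc, ← mul_assoc]
  gcongr
  exact hb j

/-- The coefficients `(m)_j / (μ)_j` of Kummer's function. -/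
noncomputable def kummerCoeff (m μ : ℝ) (j : ℕ) : ℝ :=
  Real.Gamma (m + j) / Real.Gamma m * (Real.Gamma μ / Real.Gamma (μ + j))

/-- Kummer's confluent hypergeometric function `₁F₁(m; μ; z)`. -/
noncomputable def kummer (m μ z : ℝ) : ℝ :=
  ∑' j : ℕ, kummerCoeff m μ j * z ^ j / (j.factorial : ℝ)

theorem Gamma_add_natCast_succ {a : ℝ} (ha : 0 < a) (j : ℕ) :
    Real.Gamma (a + (j + 1 : ℕ)) = (a + j) * Real.Gamma (a + j) := by
  have : 0 < a + j := by positivity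
  rw [← Real.Gamma_add_one this.ne']
  congr 1
  push_cast
  ring

theorem Gamma_add_natCast_pos {a : ℝ} (ha : 0 < a) (j : ℕ) : 0 < Real.Gamma (a + j) :=
  Real.Gamma_pos_of_pos (by positivity)

theorem kummerCoeff_nonneg {m μ : ℝ} (hm : 0 < m) (hμ : 0 < μ) (j : ℕ) :
    0 ≤ kummerCoeff m μ j := by
  have h1 := Gamma_add_natCast_pos hm j
  have h2 := Gamma_add_natCast_pos hμ j
  have h3 := Real.Gamma_pos_of_pos hm
  have h4 := Real.Gamma_pos_of_pos hμ
  unfold kummerCoeff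
  positivity

theorem summable_kummer {m μ : ℝ} (hm : 0 < m) (hμ : 0 < μ) (z : ℝ) :
    Summable fun j : ℕ => kummerCoeff m μ j * z ^ j / (j.factorial : ℝ) := by
  refine summable_mul_pow_div_factorial (kummerCoeff_nonneg hm hμ) (C := 1 + m / μ)
    (by positivity) (fun j => ?_) z
  have h2 := Gamma_add_natCast_pos hμ j
  have hj : 0 < μ + j := by positivity
  have e : kummerCoeff m μ (j + 1) = (m + j) / (μ + j) * kummerCoeff m μ j := by
    unfold kummerCoeff
    rw [Gamma_add_natCast_succ hm, Gamma_add_natCast_succ hμ]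
    field_simp
  rw [e]
  refine mul_le_mul_of_nonneg_right ?_ (kummerCoeff_nonneg hm hμ j)
  rw [div_le_iff₀ hj]
  have : (1 + m / μ) * (μ + j) = m + j + μ + m / μ * j := by field_simp; ring
  rw [this]
  have : 0 ≤ m / μ * j := by positivity
  linarith

theorem summable_bessel {μ : ℝ} (hμ : 0 < μ) (z : ℝ) :
    Summable fun j : ℕ => 1 / Real.Gamma (μ + j) * z ^ j / (j.factorial : ℝ) := by
  refine summable_mul_pow_div_factorial
    (fun j => (one_div_pos.2 (Gamma_add_natCast_pos hμ j)).le) (C := 1 / μ) (by positivity)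
    (fun j => ?_) z
  have h2 := Gamma_add_natCast_pos hμ j
  have hj : μ ≤ μ + j := by simp
  rw [Gamma_add_natCast_succ hμ, ← one_div_mul_one_div]
  gcongr

/-- Weierstrass test on a ball: the coefficients are nonnegative, so the series at the radius is a
majorant. -/
theorem continuous_kummer {m μ : ℝ} (hm : 0 < m) (hμ : 0 < μ) : Continuous (kummer m μ) := by
  refine continuous_iff_continuousAt.2 fun z₀ => ?_
  have hc : ContinuousOn (kummer m μ) (Metric.closedBall 0 (|z₀| + 1)) := by
    refine continuousOn_tsum (fun j => by fun_prop) (summable_kummer hm hμ (|z₀| + 1)) ?_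
    intro j z hz
    rw [mem_closedBall_zero_iff, Real.norm_eq_abs] at hz
    rw [Real.norm_eq_abs, abs_div, abs_mul, abs_pow, abs_of_nonneg (kummerCoeff_nonneg hm hμ j),
      Nat.abs_cast]
    have := kummerCoeff_nonneg hm hμ j
    gcongr
  refine hc.continuousAt (Metric.closedBall_mem_nhds_of_mem ?_)
  simp

theorem kummer_nonneg {m μ : ℝ} (hm : 0 < m) (hμ : 0 < μ) {z : ℝ} (hz : 0 ≤ z) :
    0 ≤ kummer m μ z :=
  tsum_nonneg fun j => by
    have := kummerCoeff_nonneg hm hμ j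
    positivity

theorem kummer_zero {m μ : ℝ} (hm : 0 < m) (hμ : 0 < μ) : kummer m μ 0 = 1 := by
  have h3 := Real.Gamma_pos_of_pos hm
  have h4 := Real.Gamma_pos_of_pos hμ
  rw [kummer, tsum_eq_single 0]
  · simp [kummerCoeff, h3.ne', h4.ne']
  · intro j hj
    simp [hj]

/-! ### Density of a single shadowed variable -/

/-- The conditional `κ-μ` density as a Poisson mixture of gamma densities, for all `κ ≥ 0`. -/
theorem kappaMuCondPDF_eq_tsum {γbar κ μ ξ x : ℝ} (hγ : 0 < γbar) (hκ : 0 ≤ κ) (hμ : 0 < μ)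
    (hξ : 0 < ξ) (hx : 0 < x) :
    kappaMuCondPDF γbar κ μ ξ x =
      (μ * (1 + κ) / γbar) ^ μ * x ^ (μ - 1) * Real.exp (-(μ * (1 + κ) / γbar * x)) *
        Real.exp (-(μ * κ * ξ ^ 2)) *
        ∑' j : ℕ, 1 / Real.Gamma (μ + j) * (μ * κ * ξ ^ 2 * (μ * (1 + κ) / γbar * x)) ^ j /
          (j.factorial : ℝ) := by
  rcases hκ.eq_or_lt with rfl | hκ
  -- At `κ = 0` only the term `j = 0` survives, since `0 ^ 0 = 1`; it is the gamma density.
  · rw [tsum_eq_single 0 (by intro j hj; simp [hj])]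
    simp [kappaMuCondPDF, gammaPDFReal, hx.le]
    ring
  rw [kappaMuCondPDF, if_neg hκ.ne']
  set r := μ * (1 + κ) / γbar with hr
  have hr0 : 0 < r := by positivity
  set u := κ * (1 + κ) * x / γbar with hu
  have hu0 : 0 < u := by positivity
  have hw : 0 < μ * ξ * √u := by positivity
  have hw2 : (μ * ξ * √u) ^ 2 = μ * κ * ξ ^ 2 * (r * x) := by
    rw [mul_pow, Real.sq_sqrt hu0.le, hu, hr]
    field_simp
  -- The leading power `w ^ (μ - 1)` is written as `(w ^ 2) ^ ((μ - 1) / 2)` to share its exponent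
  -- with the prefactors.
  have hB : besselI (μ - 1) (2 * μ * ξ * √u) = ((μ * ξ * √u) ^ 2) ^ ((μ - 1) / 2) *
      ∑' j : ℕ, 1 / Real.Gamma (μ + j) * (μ * κ * ξ ^ 2 * (r * x)) ^ j / (j.factorial : ℝ) := by
    rw [besselI, ← tsum_mul_left]
    refine tsum_congr fun j => ?_
    have e : 2 * μ * ξ * √u / 2 = μ * ξ * √u := by ring
    rw [e, Real.rpow_add hw, ← hw2, ← pow_mul, ← Real.rpow_natCast (μ * ξ * √u) 2,
      ← Real.rpow_mul hw.le, ← Real.rpow_natCast (μ * ξ * √u) (2 * j)]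
    have e1 : (j : ℝ) + (μ - 1) + 1 = μ + j := by ring
    have e2 : ((2 : ℕ) : ℝ) * ((μ - 1) / 2) = μ - 1 := by push_cast; ring
    rw [e1, e2]
    push_cast
    have := Gamma_add_natCast_pos hμ j
    field_simp
  rw [hB, hw2]
  have hξe : Real.exp (-(μ * κ * ξ ^ 2)) = (Real.exp (ξ ^ 2 * μ * κ))⁻¹ := by
    rw [← Real.exp_neg]
    congr 1
    ring
  have hre : μ * (1 + κ) * x / γbar = r * x := by rw [hr]; ring
  -- Under the common exponent `(μ - 1) / 2` the bases multiply to `(r * x) ^ 2`, so `κ` and `ξ`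
  -- cancel; the spare factor `(1 + κ) * (μ / γbar)` is `r`.
  have hpow : (1 + κ) ^ ((μ + 1) / 2) / κ ^ ((μ - 1) / 2) * (x / (ξ ^ 2 * γbar)) ^ ((μ - 1) / 2) *
      (μ * κ * ξ ^ 2 * (r * x)) ^ ((μ - 1) / 2) * (μ / γbar) = r ^ μ * x ^ (μ - 1) := by
    have e1 : (μ + 1) / 2 = (μ - 1) / 2 + 1 := by ring
    have e2 : r ^ μ = r ^ (μ - 1) * r := by
      rw [← Real.rpow_add_one hr0.ne']
      congr 1
      ring
    have e3 : r ^ (μ - 1) * x ^ (μ - 1) = ((r * x) ^ 2) ^ ((μ - 1) / 2) := by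
      rw [← Real.mul_rpow hr0.le hx.le, ← Real.rpow_natCast, ← Real.rpow_mul (by positivity)]
      congr 1
      push_cast
      ring
    have e4 : (r * x) ^ 2 =
        (1 + κ) / κ * (x / (ξ ^ 2 * γbar)) * (μ * κ * ξ ^ 2 * (r * x)) := by
      rw [hr]
      field_simp
    have e5 : ∀ {v w : ℝ}, 0 < v → 0 < w → ((1 + κ) / κ * v * w) ^ ((μ - 1) / 2) =
        (1 + κ) ^ ((μ - 1) / 2) / κ ^ ((μ - 1) / 2) * v ^ ((μ - 1) / 2) * w ^ ((μ - 1) / 2) := by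
      intro v w hv hw
      rw [Real.mul_rpow (by positivity) hw.le, Real.mul_rpow (by positivity) hv.le,
        Real.div_rpow (by positivity) hκ.le]
    rw [e1, Real.rpow_add_one (by positivity), e2, mul_right_comm (r ^ (μ - 1)), e3, e4,
      e5 (by positivity) (by positivity),
      show (1 + κ) ^ ((μ - 1) / 2) * (1 + κ) / κ ^ ((μ - 1) / 2) =
        (1 + κ) ^ ((μ - 1) / 2) / κ ^ ((μ - 1) / 2) * (1 + κ) by ring]
    generalize (1 + κ) ^ ((μ - 1) / 2) / κ ^ ((μ - 1) / 2) = t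
    generalize (x / (ξ ^ 2 * γbar)) ^ ((μ - 1) / 2) = v
    generalize (μ * κ * ξ ^ 2 * (r * x)) ^ ((μ - 1) / 2) = w
    rw [hr]
    ring
  rw [hξe, hre, ← hpow]
  field_simp

theorem lintegral_rpow_mul_exp_neg_mul_sq {q b : ℝ} (hq : -1 < q) (hb : 0 < b) :
    ∫⁻ ξ in Set.Ioi (0 : ℝ), ENNReal.ofReal (ξ ^ q * Real.exp (-(b * ξ ^ 2))) =
      ENNReal.ofReal (b ^ (-(q + 1) / 2) / 2 * Real.Gamma ((q + 1) / 2)) := by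
  have e := integral_rpow_mul_exp_neg_mul_rpow (p := 2) two_pos hq hb
  have i := integrableOn_rpow_mul_exp_neg_mul_sq hb hq
  have e' : b ^ (-(q + 1) / 2) / 2 * Real.Gamma ((q + 1) / 2) =
      ∫ ξ in Set.Ioi (0 : ℝ), ξ ^ q * Real.exp (-(b * ξ ^ 2)) := by
    rw [div_eq_mul_one_div _ (2 : ℝ), ← e]
    simp [neg_mul]
  rw [e', ofReal_integral_eq_lintegral_ofReal]
  · simpa [neg_mul] using i.integrable
  · refine ae_restrict_of_forall_mem measurableSet_Ioi fun ξ (hξ : 0 < ξ) => ?_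
    positivity

/-- The factor of `x ^ (μ - 1) / Γ(μ)` in the density of the `κ-μ` shadowed distribution. -/
noncomputable def shadowedFactor (γbar κ μ m x : ℝ) : ℝ :=
  μ ^ μ * m ^ m * (1 + κ) ^ μ / (μ * κ + m) ^ m * (1 / γbar) ^ μ *
    (Real.exp (-(μ * (1 + κ) / γbar * x)) *
      kummer m μ (μ * κ / (μ * κ + m) * (μ * (1 + κ) / γbar * x)))

/-- The two exponentials in `ξ ^ 2` merge into rate `μ κ + m`. The resulting Gaussian moment
contributes `Γ(m + j) / (2 (μ κ + m) ^ (m + j))`, whence the numerator of the Kummer coefficient and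
the ratio `μ κ / (μ κ + m)`. -/
theorem lintegral_mixture_term {γbar κ μ m x : ℝ} (hγ : 0 < γbar) (hκ : 0 ≤ κ) (hμ : 0 < μ)
    (hm : 0 < m) (hx : 0 < x) (j : ℕ) :
    ∫⁻ ξ in Set.Ioi (0 : ℝ), ENNReal.ofReal
      ((μ * (1 + κ) / γbar) ^ μ * x ^ (μ - 1) * Real.exp (-(μ * (1 + κ) / γbar * x)) *
        Real.exp (-(μ * κ * ξ ^ 2)) *
        (1 / Real.Gamma (μ + j) * (μ * κ * ξ ^ 2 * (μ * (1 + κ) / γbar * x)) ^ j /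
          (j.factorial : ℝ)) * nakagamiPDF m ξ) =
    ENNReal.ofReal (x ^ (μ - 1) / Real.Gamma μ *
      (μ ^ μ * m ^ m * (1 + κ) ^ μ / (μ * κ + m) ^ m * (1 / γbar) ^ μ *
        (Real.exp (-(μ * (1 + κ) / γbar * x)) *
          (kummerCoeff m μ j * (μ * κ / (μ * κ + m) * (μ * (1 + κ) / γbar * x)) ^ j /
            (j.factorial : ℝ))))) := by
  have hb : 0 < μ * κ + m := by positivity
  have hG1 := Gamma_add_natCast_pos hμ j
  have hG2 := Real.Gamma_pos_of_pos hm
  have hG3 := Real.Gamma_pos_of_pos hμ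
  set r := μ * (1 + κ) / γbar with hr
  have hr0 : 0 < r := by positivity
  set K := r ^ μ * x ^ (μ - 1) * Real.exp (-(r * x)) *
    (1 / Real.Gamma (μ + j) * (μ * κ * (r * x)) ^ j / (j.factorial : ℝ)) *
      (2 * m ^ m / Real.Gamma m) with hK
  have hK0 : 0 ≤ K := by positivity
  have e : ∀ ξ ∈ Set.Ioi (0 : ℝ), ENNReal.ofReal
      (r ^ μ * x ^ (μ - 1) * Real.exp (-(r * x)) * Real.exp (-(μ * κ * ξ ^ 2)) *
        (1 / Real.Gamma (μ + j) * (μ * κ * ξ ^ 2 * (r * x)) ^ j / (j.factorial : ℝ)) *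
          nakagamiPDF m ξ) = ENNReal.ofReal K *
      ENNReal.ofReal (ξ ^ (2 * m - 1 + 2 * j) * Real.exp (-((μ * κ + m) * ξ ^ 2))) := by
    intro ξ hξ
    have hξ : 0 < ξ := hξ
    have e1 : ξ ^ (2 * m - 1 + 2 * j) = ξ ^ (2 * m - 1) * (ξ ^ 2) ^ j := by
      rw [Real.rpow_add hξ, ← pow_mul, ← Real.rpow_natCast ξ (2 * j)]
      push_cast
      rfl
    have e2 : Real.exp (-((μ * κ + m) * ξ ^ 2)) =
        Real.exp (-(μ * κ * ξ ^ 2)) * Real.exp (-(m * ξ ^ 2)) := by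
      rw [← Real.exp_add]
      congr 1
      ring
    rw [← ENNReal.ofReal_mul hK0, e1, e2, hK, nakagamiPDF,
      show μ * κ * ξ ^ 2 * (r * x) = μ * κ * (r * x) * ξ ^ 2 by ring, mul_pow _ (ξ ^ 2)]
    congr 1
    ring
  have hq : -1 < 2 * m - 1 + 2 * (j : ℝ) := by
    have : (0 : ℝ) ≤ j := j.cast_nonneg
    linarith
  rw [setLIntegral_congr_fun measurableSet_Ioi e,
    lintegral_const_mul _ (by fun_prop), lintegral_rpow_mul_exp_neg_mul_sq hq hb,
    ← ENNReal.ofReal_mul hK0]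
  congr 1
  have e3 : (2 * m - 1 + 2 * (j : ℝ) + 1) / 2 = m + j := by ring
  have e4 : -(2 * m - 1 + 2 * (j : ℝ) + 1) / 2 = -(m + j) := by ring
  have e5 : r ^ μ = μ ^ μ * (1 + κ) ^ μ * (1 / γbar) ^ μ := by
    rw [hr, div_eq_mul_one_div, Real.mul_rpow (by positivity) (by positivity),
      Real.mul_rpow (by positivity) (by positivity)]
  rw [e3, e4, Real.rpow_neg hb.le, Real.rpow_add hb, Real.rpow_natCast, hK, e5, kummerCoeff]
  simp only [mul_pow, div_pow]
  field_simp

/-- All terms are nonnegative, so sum and integral may be exchanged. -/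
theorem lintegral_kappaMuCondPDF_mul_nakagamiPDF {γbar κ μ m x : ℝ} (hγ : 0 < γbar) (hκ : 0 ≤ κ)
    (hμ : 0 < μ) (hm : 0 < m) (hx : 0 < x) :
    ∫⁻ ξ in Set.Ioi (0 : ℝ), ENNReal.ofReal (kappaMuCondPDF γbar κ μ ξ x * nakagamiPDF m ξ) =
      ENNReal.ofReal (powerDensity μ (shadowedFactor γbar κ μ m) x) := by
  have hG1 := Gamma_add_natCast_pos hμ
  have hG2 := Real.Gamma_pos_of_pos hm
  have hG3 := Real.Gamma_pos_of_pos hμ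
  have e : ∀ ξ ∈ Set.Ioi (0 : ℝ),
      ENNReal.ofReal (kappaMuCondPDF γbar κ μ ξ x * nakagamiPDF m ξ) =
      ∑' j : ℕ, ENNReal.ofReal
      ((μ * (1 + κ) / γbar) ^ μ * x ^ (μ - 1) * Real.exp (-(μ * (1 + κ) / γbar * x)) *
        Real.exp (-(μ * κ * ξ ^ 2)) *
        (1 / Real.Gamma (μ + j) * (μ * κ * ξ ^ 2 * (μ * (1 + κ) / γbar * x)) ^ j /
          (j.factorial : ℝ)) * nakagamiPDF m ξ) := by
    intro ξ hξ
    have hξ : 0 < ξ := hξ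
    rw [kappaMuCondPDF_eq_tsum hγ hκ hμ hξ hx, ← tsum_mul_left, ← tsum_mul_right,
      ENNReal.ofReal_tsum_of_nonneg]
    · intro j
      have := hG1 j
      unfold nakagamiPDF
      positivity
    · exact ((summable_bessel hμ _).mul_left _).mul_right _
  rw [setLIntegral_congr_fun measurableSet_Ioi e, lintegral_tsum]
  · simp_rw [lintegral_mixture_term hγ hκ hμ hm hx]
    rw [powerDensity_of_pos _ _ hx, shadowedFactor, kummer, ← tsum_mul_left, ← tsum_mul_left,
      ← tsum_mul_left, ENNReal.ofReal_tsum_of_nonneg]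
    · intro j
      have := kummerCoeff_nonneg hm hμ j
      positivity
    · exact (((summable_kummer hm hμ _).mul_left _).mul_left _).mul_left _
  · intro j
    unfold nakagamiPDF
    fun_prop

theorem kappaMuShadowed_eq_withDensity {γbar κ μ m : ℝ} (hγ : 0 < γbar) (hκ : 0 ≤ κ)
    (hμ : 0 < μ) (hm : 0 < m) :
    kappaMuShadowed γbar κ μ m =
      volume.withDensity fun x => ENNReal.ofReal
        (powerDensity μ (shadowedFactor γbar κ μ m) x) := by
  rw [kappaMuShadowed, ← withDensity_indicator measurableSet_Ioi]
  congr 1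
  ext x
  by_cases hx : 0 < x
  · rw [Set.indicator_of_mem (Set.mem_Ioi.2 hx),
      lintegral_kappaMuCondPDF_mul_nakagamiPDF hγ hκ hμ hm hx]
  · rw [Set.indicator_of_notMem (by simpa using hx), powerDensity_of_nonpos _ _ (not_lt.1 hx),
      ENNReal.ofReal_zero]

theorem continuous_shadowedFactor (γbar κ : ℝ) {μ m : ℝ} (hμ : 0 < μ) (hm : 0 < m) :
    Continuous (shadowedFactor γbar κ μ m) := by
  have := continuous_kummer hm hμ
  unfold shadowedFactor
  fun_prop

theorem shadowedFactor_nonneg {γbar κ μ m : ℝ} (hγ : 0 < γbar) (hκ : 0 ≤ κ)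
    (hμ : 0 < μ) (hm : 0 < m) (x : ℝ) (hx : 0 ≤ x) : 0 ≤ shadowedFactor γbar κ μ m x := by
  have : 0 ≤ kummer m μ (μ * κ / (μ * κ + m) * (μ * (1 + κ) / γbar * x)) :=
    kummer_nonneg hm hμ (by positivity)
  unfold shadowedFactor
  positivity

/-- Apart from the constant, the factor is a fixed continuous function of `t = μ (1 + κ) y / γbar`
with value 1 at 0, and `t` is at most its value at `y = X`, which tends to 0. -/
theorem locallyUniformlyAsymptotic_shadowedFactor {ι : Type*} {l : Filter ι} {γbar : ι → ℝ}
    (hpos : ∀ i, 0 < γbar i) (hγ : Tendsto γbar l atTop) {κ μ m : ℝ} (hκ : 0 ≤ κ)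
    (hμ : 0 < μ) (hm : 0 < m) :
    LocallyUniformlyAsymptotic l (fun i => shadowedFactor (γbar i) κ μ m)
      (fun i => μ ^ μ * m ^ m * (1 + κ) ^ μ / (μ * κ + m) ^ m * (1 / γbar i) ^ μ) := by
  intro X hX ε hε
  have hcont : Continuous fun t => Real.exp (-t) * kummer m μ (μ * κ / (μ * κ + m) * t) := by
    have := continuous_kummer hm hμ
    fun_prop
  obtain ⟨δ, hδ, H⟩ := Metric.continuousAt_iff.1 (hcont.continuousAt (x := 0)) ε hε
  have hr : Tendsto (fun i => μ * (1 + κ) / γbar i * X) l (nhds 0) := by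
    simpa using (hγ.const_div_atTop (μ * (1 + κ))).mul_const X
  filter_upwards [hr.eventually_lt_const hδ] with i hi y hy
  have hγi := hpos i
  have ht0 : 0 ≤ μ * (1 + κ) / γbar i * y := mul_nonneg (by positivity) hy.1
  have ht : μ * (1 + κ) / γbar i * y < δ :=
    (mul_le_mul_of_nonneg_left hy.2 (by positivity)).trans_lt hi
  have h1 := H (x := μ * (1 + κ) / γbar i * y) (by rwa [Real.dist_0_eq_abs, abs_of_nonneg ht0])
  simp only [neg_zero, Real.exp_zero, mul_zero, kummer_zero hm hμ, mul_one, Real.dist_eq] at h1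
  have hA : 0 ≤ μ ^ μ * m ^ m * (1 + κ) ^ μ / (μ * κ + m) ^ m * (1 / γbar i) ^ μ := by positivity
  rw [shadowedFactor, ← mul_sub_one, abs_mul, abs_of_nonneg hA, mul_comm]
  exact mul_le_mul_of_nonneg_right h1.le hA

/-! ### Sums of independent variables -/

/-- Laws with density `powerDensity a (h i)`, where `h i` is asymptotic to the constant `A i`. -/
structure HasAsymptoticPowerDensity {ι : Type*} (l : Filter ι) (a : ℝ) (A : ι → ℝ)
    (h : ι → ℝ → ℝ) (ν : ι → Measure ℝ) : Prop where
  shape_pos : 0 < a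
  const_pos : ∀ i, 0 < A i
  continuous : ∀ i, Continuous (h i)
  nonneg : ∀ i x, 0 ≤ x → 0 ≤ h i x
  law_eq : ∀ i, ν i = volume.withDensity fun x => ENNReal.ofReal (powerDensity a (h i) x)
  asymptotic : LocallyUniformlyAsymptotic l h A

namespace HasAsymptoticPowerDensity

variable {ι : Type*} {l : Filter ι} {a b : ℝ} {A B : ι → ℝ} {h k : ι → ℝ → ℝ}
  {ν ρ : ι → Measure ℝ}

theorem conv (H : HasAsymptoticPowerDensity l a A h ν) (K : HasAsymptoticPowerDensity l b B k ρ) :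
    HasAsymptoticPowerDensity l (a + b) (fun i => A i * B i)
      (fun i => betaMean a b (h i) (k i)) (fun i => Measure.conv (ν i) (ρ i)) where
  shape_pos := add_pos H.shape_pos K.shape_pos
  const_pos i := mul_pos (H.const_pos i) (K.const_pos i)
  continuous i := continuous_betaMean H.shape_pos K.shape_pos (H.continuous i) (K.continuous i)
  nonneg i := betaMean_nonneg a b (H.nonneg i) (K.nonneg i)
  law_eq i := by
    rw [H.law_eq, K.law_eq, conv_withDensity_powerDensity H.shape_pos K.shape_pos
      (H.continuous i) (K.continuous i) (H.nonneg i) (K.nonneg i)]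
  asymptotic := H.asymptotic.betaMean K.asymptotic H.const_pos K.const_pos H.continuous
    K.continuous H.shape_pos K.shape_pos

theorem isContinuousPDF (H : HasAsymptoticPowerDensity l a A h ν) (i : ι) :
    IsContinuousPDF (powerDensity a (h i)) (ν i) where
  nonneg := powerDensity_nonneg H.shape_pos (H.nonneg i)
  eq_zero _ hx := powerDensity_of_nonpos a (h i) hx
  continuousOn := continuousOn_powerDensity a (H.continuous i)
  law_eq := H.law_eq i

theorem cdf_isEquivalent (H : HasAsymptoticPowerDensity l a A h ν)
    (hν : ∀ i, IsProbabilityMeasure (ν i)) {x : ℝ} (hx : 0 < x) :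
    (fun i => cdf (ν i) x) ~[l] fun i => 1 / Real.Gamma (1 + a) * A i * x ^ a := by
  have hone := (H.asymptotic.betaMean (LocallyUniformlyAsymptotic.const l) H.const_pos
    (fun _ => one_pos) H.continuous (fun _ => continuous_const) H.shape_pos one_pos).powerDensity
    (fun i => mul_pos (H.const_pos i) one_pos) (a + 1) hx
  have e : (fun i => cdf (ν i) x) =
      fun i => powerDensity (a + 1) (betaMean a 1 (h i) fun _ => 1) x := by
    funext i
    exact cdf_withDensity_powerDensity H.shape_pos (H.continuous i) (H.nonneg i) (ν i)
      (H.law_eq i) x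
  rw [e, add_comm 1 a]
  simpa using hone

end HasAsymptoticPowerDensity

theorem hasAsymptoticPowerDensity_kappaMuShadowed {ι : Type*} {l : Filter ι} {γbar : ι → ℝ}
    (hpos : ∀ i, 0 < γbar i) (hγ : Tendsto γbar l atTop) {κ μ m : ℝ} (hκ : 0 ≤ κ)
    (hμ : 0 < μ) (hm : 0 < m) :
    HasAsymptoticPowerDensity l μ
      (fun i => μ ^ μ * m ^ m * (1 + κ) ^ μ / (μ * κ + m) ^ m * (1 / γbar i) ^ μ)
      (fun i => shadowedFactor (γbar i) κ μ m) (fun i => kappaMuShadowed (γbar i) κ μ m) where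
  shape_pos := hμ
  const_pos i := by
    have := hpos i
    positivity
  continuous i := continuous_shadowedFactor (γbar i) κ hμ hm
  nonneg i := shadowedFactor_nonneg (hpos i) hκ hμ hm
  law_eq i := kappaMuShadowed_eq_withDensity (hpos i) hκ hμ hm
  asymptotic := locallyUniformlyAsymptotic_shadowedFactor hpos hγ hκ hμ hm

/-- Sums of independent variables whose laws have asymptotic power densities. -/
theorem exists_hasAsymptoticPowerDensity_sum {ι K : Type*} {l : Filter ι} {a : K → ℝ}
    {A : ι → K → ℝ} {h : K → ι → ℝ → ℝ} {ν : ι → K → Measure ℝ}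
    (H : ∀ k, HasAsymptoticPowerDensity l (a k) (fun i => A i k) (h k) (fun i => ν i k))
    {Ω : ι → Type*} [∀ i, MeasurableSpace (Ω i)]
    (P : ∀ i, Measure (Ω i)) [∀ i, IsProbabilityMeasure (P i)] (X : ∀ i, K → Ω i → ℝ)
    (hX : ∀ i k, HasLaw (X i k) (ν i k) (P i)) (hindep : ∀ i, iIndepFun (X i) (P i))
    {s : Finset K} (hs : s.Nonempty) :
    ∃ g : ι → ℝ → ℝ, HasAsymptoticPowerDensity l (∑ k ∈ s, a k) (fun i => ∏ k ∈ s, A i k) g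
      (fun i => (P i).map (∑ k ∈ s, X i k)) := by
  induction hs using Finset.Nonempty.cons_induction with
  | singleton k =>
    refine ⟨h k, ?_⟩
    have e : (fun i => (P i).map (∑ k ∈ {k}, X i k)) = fun i => ν i k := by
      funext i
      rw [Finset.sum_singleton, (hX i k).map_eq]
    rw [e]
    simpa using H k
  | cons k s hks hs ih =>
    obtain ⟨g, hg⟩ := ih
    refine ⟨fun i => betaMean (∑ k ∈ s, a k) (a k) (g i) (h k i), ?_⟩
    have e : (fun i => (P i).map (∑ k ∈ Finset.cons k s hks, X i k)) =
        fun i => Measure.conv ((P i).map (∑ k ∈ s, X i k)) (ν i k) := by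
      funext i
      have hm : ∀ k, AEMeasurable (X i k) (P i) := fun k => (hX i k).aemeasurable
      rw [Finset.sum_cons, add_comm, IndepFun.map_add_eq_map_conv_map₀
        (Finset.aemeasurable_sum s fun k _ => hm k) (hm k)
        ((hindep i).indepFun_finsetSum_of_notMem₀ hm hks), (hX i k).map_eq]
    rw [e]
    simp only [Finset.sum_cons, Finset.prod_cons, add_comm (a k), mul_comm (A _ k)]
    exact hg.conv (H k)

theorem corollary2 (M : ℕ) (hM : 1 ≤ M) (κ μ m : Fin M → ℝ)
    (hκ : ∀ k, 0 ≤ κ k) (hμ : ∀ k, 0 < μ k) (hm : ∀ k, 0 < m k)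
    {ι : Type*} (l : Filter ι)
    (γbar : ι → Fin M → ℝ) (hγbar_pos : ∀ i k, 0 < γbar i k)
    (hγbar : ∀ k, Tendsto (fun i => γbar i k) l atTop)
    {Ω : ι → Type*} [∀ i, MeasurableSpace (Ω i)]
    (P : ∀ i, Measure (Ω i)) [∀ i, IsProbabilityMeasure (P i)]
    (X : ∀ i, Fin M → Ω i → ℝ)
    (hX : ∀ i k, HasLaw (X i k) (kappaMuShadowed (γbar i k) (κ k) (μ k) (m k)) (P i))
    (hindep : ∀ i, iIndepFun (X i) (P i)) :
    ∃ f : ι → ℝ → ℝ,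
      (∀ i, IsContinuousPDF (f i) ((P i).map fun ω => ∑ k, X i k ω)) ∧
      (∀ x : ℝ, 0 < x →
        (fun i => f i x) ~[l] fun i =>
          (1 / Real.Gamma (∑ k, μ k) *
            ∏ k, (μ k ^ μ k * m k ^ m k * (1 + κ k) ^ μ k / (μ k * κ k + m k) ^ m k
              * (1 / γbar i k) ^ μ k))
          * x ^ ((∑ k, μ k) - 1)) ∧
      (∀ x : ℝ, 0 < x →
        (fun i => cdf ((P i).map fun ω => ∑ k, X i k ω) x) ~[l] fun i =>
          (1 / Real.Gamma (1 + ∑ k, μ k) *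
            ∏ k, (μ k ^ μ k * m k ^ m k * (1 + κ k) ^ μ k / (μ k * κ k + m k) ^ m k
              * (1 / γbar i k) ^ μ k))
          * x ^ (∑ k, μ k)) := by
  -- The induction starts from one summand: the empty sum is a point mass at 0 and has no density.
  have : Nonempty (Fin M) := ⟨⟨0, hM⟩⟩
  obtain ⟨g, hg⟩ := exists_hasAsymptoticPowerDensity_sum
    (fun k => hasAsymptoticPowerDensity_kappaMuShadowed (fun i => hγbar_pos i k) (hγbar k)
      (hκ k) (hμ k) (hm k)) P X hX hindep Finset.univ_nonempty
  have e : ∀ i, (∑ k, X i k) = fun ω => ∑ k, X i k ω := fun i => by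
    ext ω
    simp
  simp only [e] at hg
  refine ⟨fun i => powerDensity (∑ k, μ k) (g i), hg.isContinuousPDF, fun x hx => ?_,
    fun x hx => ?_⟩
  · exact hg.asymptotic.powerDensity hg.const_pos _ hx
  · refine hg.cdf_isEquivalent (fun i => Measure.isProbabilityMeasure_map ?_) hx
    exact Finset.aemeasurable_fun_sum _ fun k _ => (hX i k).aemeasurable
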